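/- Let $\mathbb{F}_q$ be the finite field with $q$ elements, and let $\mathcal{F}: F(X_0,X_1,X_2)=0$ be a projective plane algebraic curve of degree $m$ defined over $\mathbb{F}_q$; that is, $F\in\mathbb{F}_q[X_0,X_1,X_2]$ is a nonzero homogeneous polynomial of degree $m\geq 1$, which need be neither irreducible nor square-free. Let $\#\mathcal{F}(\mathbb{F}_q)$ be the number of points of $\mathbb{P}^2(\mathbb{F}_q)$ on $\mathcal{F}$. A curve defined over $\mathbb{F}_q$ is called absolutely irreducible if its defining polynomial is irreducible over the algebraic closure of $\mathbb{F}_q$. An absolutely irreducible curve $G=0$ defined over $\mathbb{F}_q$ is called $\mathbb{F}_q$-Frobenius nonclassical if $G$ divides $$\Phi_q(G)=X_0^{q}\frac{\partial G}{\partial X_0}+X_1^{q}\frac{\partial G}{\partial X_1}+X_2^{q}\frac{\partial G}{\partial X_2},$$ and $\mathbb{F}_q$-Frobenius classical otherwise. Suppose that every absolutely irreducible component of $\mathcal{F}$ defined over $\mathbb{F}_q$ is $\mathbb{F}_q$-Frobenius classical. Then $$\#\mathcal{F}(\mathbb{F}_q)\leq \frac{m(m+q-1)}{2}.$$ Moreover,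 if $$\#\mathcal{F}(\mathbb{F}_q)\geq \frac{m(m+q-1)}{2}-\max\{m-1,\,2m-5\},$$ then $\mathcal{F}$ is absolutely irreducible. -/

import Mathlib

open MvPolynomial
open scoped LinearAlgebra.Projectivization

/-- `F` is (the defining form of) a projective plane curve of degree `m` over `K`: a nonzero
homogeneous polynomial of degree `m ≥ 1` in `X₀, X₁, X₂`. It need not be irreducible or reduced. -/
def IsPlaneCurve {K : Type*} [Field K] (F : MvPolynomial (Fin 3) K) (m : ℕ) : Prop :=
  0 < m ∧ F ≠ 0 ∧ F.IsHomogeneous m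

/-- `F` is absolutely irreducible: irreducible over an algebraic closure of `K`. -/
def IsAbsolutelyIrreducible {K : Type*} [Field K] (F : MvPolynomial (Fin 3) K) : Prop :=
  Irreducible (MvPolynomial.map (algebraMap K (AlgebraicClosure K)) F)

/-- `G` is an absolutely irreducible component, defined over `K`, of the plane curve `F`. -/
def IsAbsolutelyIrreducibleComponent {K : Type*} [Field K] (G F : MvPolynomial (Fin 3) K) : Prop :=
  (∃ d : ℕ, IsPlaneCurve G d) ∧ IsAbsolutelyIrreducible G ∧ G ∣ F

/-- `Φ_q(Q) = X₀^q ∂Q/∂X₀ + X₁^q ∂Q/∂X₁ + X₂^q ∂Q/∂X₂`. -/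
noncomputable def frobeniusPhi {K : Type*} [Field K] (q : ℕ) (Q : MvPolynomial (Fin 3) K) :
    MvPolynomial (Fin 3) K :=
  ∑ i : Fin 3, X i ^ q * pderiv i Q

/-- The curve `Q = 0` is `F_q`-Frobenius nonclassical: `Q` divides `Φ_q(Q)`. -/
def IsFrobeniusNonclassical {K : Type*} [Field K] (q : ℕ) (Q : MvPolynomial (Fin 3) K) : Prop :=
  Q ∣ frobeniusPhi q Q

/-- The curve `Q = 0` is `F_q`-Frobenius classical. -/
def IsFrobeniusClassical {K : Type*} [Field K] (q : ℕ) (Q : MvPolynomial (Fin 3) K) : Prop :=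
  ¬ IsFrobeniusNonclassical q Q

/-- The points of `ℙ²(K)` on the curve `F = 0`. For homogeneous `F` the choice of the
representative `P.rep` does not matter, see `mk_mem_rationalPoints`. -/
def rationalPoints {K : Type*} [Field K] (F : MvPolynomial (Fin 3) K) : Set (ℙ K (Fin 3 → K)) :=
  {P | eval P.rep F = 0}

theorem mk_mem_rationalPoints {K : Type*} [Field K] {F : MvPolynomial (Fin 3) K} {m : ℕ}
    (hF : F.IsHomogeneous m) (v : Fin 3 → K) (hv : v ≠ 0) :
    Projectivization.mk K v hv ∈ rationalPoints F ↔ eval v F = 0 := by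
  obtain ⟨a, ha⟩ := Projectivization.exists_smul_eq_mk_rep K v hv
  have h : eval (a • v) F = (a : K) ^ m * eval v F := by
    rw [MvPolynomial.eval_eq, MvPolynomial.eval_eq, Finset.mul_sum]
    refine Finset.sum_congr rfl fun d hd => ?_
    have hdeg : d.degree = m := by
      rw [Finsupp.degree_eq_weight_one]
      exact hF (mem_support_iff.mp hd)
    have hs : ∏ i ∈ d.support, (a : K) ^ d i = (a : K) ^ m := by
      rw [Finset.prod_pow_eq_pow_sum, ← hdeg]; rfl
    simp only [Pi.smul_apply, Units.smul_def, smul_eq_mul, mul_pow, Finset.prod_mul_distrib, hs]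
    ring
  change eval (Projectivization.mk K v hv).rep F = 0 ↔ _
  rw [← ha, h]
  simp

/-! Let `G` be irreducible over `K`, of degree d, with N rational points. If `G` is absolutely
irreducible and Frobenius classical, it is coprime to Φ_q(G), a form of degree d + q - 1. At a
rational point of `G`, Euler's relation makes Φ_q(G) vanish along every tangent vector of `G`, so
the point counts twice in Bézout's inequality and 2N ≤ d(d + q - 1)
(`ncard_rationalPoints_mul_two_le`). If `G` is not absolutely irreducible, its rational points lie
on two coprime Frobenius-conjugate factors of degree at most d/2, and 4N ≤ d²
(`ncard_rationalPoints_mul_four_le`).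

For a product of forms of degrees a + b = m, adding the two bounds leaves a gap of ab below the
bound for m. Lines are Frobenius nonclassical, so a, b ≥ 2 and ab ≥ 2m - 4, which exceeds max(m - 1,
2m - 5) because m ≥ 4.

Bézout's inequality comes from a dimension count: forms of large degree modulo `G` and `H` span at
most de dimensions, yet surject onto a product of copies of `K` or `K[ε]`, one for each point
(`finrank_mul_card_le_mul_of_isRelPrime`). -/

namespace MvPolynomial

/-! ### Homogeneous factors and dimensions of spaces of forms. -/

theorem order_coe_le_totalDegree {σ R : Type*} [CommSemiring R] {f : MvPolynomial σ R}
    (hf : f ≠ 0) : (f : MvPowerSeries σ R).order ≤ f.totalDegree := by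
  obtain ⟨d, hd⟩ := support_nonempty.mpr hf
  have h : MvPowerSeries.coeff d (f : MvPowerSeries σ R) ≠ 0 := by
    simpa using hd
  refine (MvPowerSeries.order_le h).trans ?_
  have := le_totalDegree hd
  rw [Finsupp.degree_apply]
  exact_mod_cast this

theorem isHomogeneous_of_totalDegree_le_order {σ R : Type*} [CommSemiring R]
    {f : MvPolynomial σ R} (h : (f.totalDegree : ℕ∞) ≤ (f : MvPowerSeries σ R).order) :
    f.IsHomogeneous f.totalDegree := by
  intro d hd
  rw [show Finsupp.weight 1 d = d.degree from (DFunLike.congr_fun Finsupp.degree_eq_weight_one d).symm]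
  refine le_antisymm ?_ ?_
  · exact le_totalDegree (mem_support_iff.mpr hd)
  · have h' : MvPowerSeries.coeff d (f : MvPowerSeries σ R) ≠ 0 := by simpa using hd
    exact_mod_cast h.trans (MvPowerSeries.order_le h')

/-- A factor of a nonzero homogeneous polynomial over a domain is homogeneous. -/
theorem IsHomogeneous.left_of_mul {σ R : Type*} [CommRing R] [IsDomain R]
    {f g : MvPolynomial σ R} {n : ℕ} (h : (f * g).IsHomogeneous n) (hne : f * g ≠ 0) :
    f.IsHomogeneous f.totalDegree := by
  have hf := left_ne_zero_of_mul hne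
  have hg := right_ne_zero_of_mul hne
  have h1 := order_coe_le_totalDegree hf
  have h2 := order_coe_le_totalDegree hg
  -- Lowest degree (the power series order) and total degree are both additive over a domain. They
  -- agree on the product, hence on each factor.
  have h3 : (f.totalDegree + g.totalDegree : ℕ) ≤
      (f : MvPowerSeries σ R).order + (g : MvPowerSeries σ R).order := by
    rw [← MvPowerSeries.order_mul, ← totalDegree_mul_of_isDomain hf hg, h.totalDegree hne,
      ← coe_mul]
    refine MvPowerSeries.le_order fun d hd => ?_
    rw [coeff_coe]
    exact h.coeff_eq_zero (by exact_mod_cast hd.ne)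
  apply isHomogeneous_of_totalDegree_le_order
  generalize (f : MvPowerSeries σ R).order = a at *
  generalize (g : MvPowerSeries σ R).order = b at *
  lift a to ℕ using (h1.trans_lt (ENat.natCast_lt_top _)).ne
  lift b to ℕ using (h2.trans_lt (ENat.natCast_lt_top _)).ne
  norm_cast at *
  omega

theorem IsHomogeneous.of_dvd {σ R : Type*} [CommRing R] [IsDomain R]
    {f g : MvPolynomial σ R} {n : ℕ} (h : g.IsHomogeneous n) (hg : g ≠ 0) (hfg : f ∣ g) :
    f.IsHomogeneous f.totalDegree := by
  obtain ⟨c, rfl⟩ := hfg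
  exact h.left_of_mul hg

theorem IsHomogeneous.of_mul_left {σ R : Type*} [CommRing R] [IsDomain R]
    {f g : MvPolynomial σ R} {d e : ℕ} (hf : f.IsHomogeneous d) (hf0 : f ≠ 0)
    (h : (f * g).IsHomogeneous (d + e)) : g.IsHomogeneous e := by
  by_cases hg : g = 0
  · rw [hg]; exact isHomogeneous_zero _ _ _
  have hne := mul_ne_zero hf0 hg
  have h1 := (mul_comm f g ▸ h : (g * f).IsHomogeneous _).left_of_mul (mul_comm f g ▸ hne)
  have h2 := h.totalDegree hne
  rw [totalDegree_mul_of_isDomain hf0 hg, hf.totalDegree hf0] at h2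
  rwa [show e = g.totalDegree by omega]

theorem finrank_homogeneousSubmodule (K : Type*) [Field K] (k n : ℕ) :
    Module.finrank K (homogeneousSubmodule (Fin (k + 1)) K n) = (n + k).choose k := by
  rw [homogeneousSubmodule_eq_finsupp_supported,
    (AddMonoidAlgebra.supportedEquivFinsupp (R := K) (S := K) _).finrank_eq]
  have hs : {d : Fin (k + 1) →₀ ℕ | d.degree = n} =
      ((Finset.univ : Finset (Fin (k + 1))).finsuppAntidiag n : Set (Fin (k + 1) →₀ ℕ)) := by
    ext d
    simp [Finset.mem_finsuppAntidiag, Finsupp.degree_eq_sum]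
  rw [hs, Module.finrank_finsupp_self, ← Nat.card_eq_fintype_card, Nat.card_coe_set_eq,
    Set.ncard_coe_finset,
    Finset.card_finsuppAntidiag_nat_eq_choose, Finset.card_univ, Fintype.card_fin,
    show k + 1 + n - 1 = n + k by omega]
  exact Nat.choose_symm_of_eq_add (by omega)

theorem finrank_map_mul_homogeneousSubmodule {K : Type*} [Field K] {k : ℕ}
    {G : MvPolynomial (Fin (k + 1)) K} (hG : G ≠ 0) (n : ℕ) :
    Module.finrank K ((homogeneousSubmodule (Fin (k + 1)) K n).map (LinearMap.mulLeft K G)) =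
      (n + k).choose k := by
  rw [← finrank_homogeneousSubmodule K k n]
  exact (Submodule.equivMapOfInjective _
    (fun a b h => mul_left_cancel₀ hG h) _).finrank_eq.symm

instance finite_homogeneousSubmodule {σ K : Type*} [Finite σ] [Field K] (n : ℕ) :
    Module.Finite K (homogeneousSubmodule σ K n) :=
  Module.Finite.iff_fg.mpr (homogeneousSubmodule_fg σ K n)

theorem two_mul_choose_two (n : ℕ) : 2 * (n + 2).choose 2 = (n + 2) * (n + 1) := by
  rw [Nat.choose_two_right]
  have h : (n + 2) * (n + 2 - 1) % 2 = 0 := by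
    rw [show n + 2 - 1 = n + 1 by omega, Nat.mul_mod]
    rcases Nat.mod_two_eq_zero_or_one n with h | h <;> simp [Nat.add_mod, h]
  rw [Nat.mul_div_cancel' (Nat.dvd_of_mod_eq_zero h)]
  rfl

/-! ### Bézout's inequality by counting dimensions. -/

/-- The forms of large degree modulo two coprime forms `G`, `H` in three variables make up a space
of dimension at most `deg G * deg H`. -/
theorem finrank_le_mul_of_isRelPrime {K W : Type*} [Field K] [AddCommGroup W] [Module K W]
    [Module.Finite K W] {G H : MvPolynomial (Fin 3) K} {d e : ℕ} (hG : G.IsHomogeneous d)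
    (hH : H.IsHomogeneous e) (hG0 : G ≠ 0) (hH0 : H ≠ 0) (hGH : IsRelPrime G H)
    (f : MvPolynomial (Fin 3) K →ₗ[K] W) (hfG : ∀ a, f (G * a) = 0) (hfH : ∀ a, f (H * a) = 0)
    (k : ℕ) (hf : ∀ w, ∃ p : MvPolynomial (Fin 3) K, p.IsHomogeneous (d + e + k) ∧ f p = w) :
    Module.finrank K W ≤ d * e := by
  set V := homogeneousSubmodule (Fin 3) K
  set A := (V (e + k)).map (LinearMap.mulLeft K G) with hA
  set B := (V (d + k)).map (LinearMap.mulLeft K H) with hB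
  -- By coprimality, a common multiple of `G` and `H` is a multiple of `G * H`.
  have hinf : A ⊓ B ≤ (V k).map (LinearMap.mulLeft K (G * H)) := by
    rintro _ ⟨⟨a, ha, rfl⟩, ⟨b, hb, hab⟩⟩
    simp only [LinearMap.mulLeft_apply] at hab ⊢
    obtain ⟨c, rfl⟩ : H ∣ a := hGH.symm.dvd_of_dvd_mul_left ⟨b, hab.symm⟩
    exact ⟨c, hH.of_mul_left hH0 ha, by simp⟩
  have hAV : A ≤ V (d + e + k) := by
    rintro _ ⟨a, ha, rfl⟩
    rw [add_assoc]
    exact hG.mul ha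
  have hBV : B ≤ V (d + e + k) := by
    rintro _ ⟨b, hb, rfl⟩
    rw [show d + e + k = e + (d + k) by ring]
    exact hH.mul hb
  have hdA : Module.finrank K A = (e + k + 2).choose 2 :=
    finrank_map_mul_homogeneousSubmodule (k := 2) hG0 _
  have hdB : Module.finrank K B = (d + k + 2).choose 2 :=
    finrank_map_mul_homogeneousSubmodule (k := 2) hH0 _
  have hdI : Module.finrank K ↥(A ⊓ B) ≤ (k + 2).choose 2 :=
    (Submodule.finrank_mono hinf).trans_eq
      (finrank_map_mul_homogeneousSubmodule (k := 2) (mul_ne_zero hG0 hH0) _)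
  have hdV : Module.finrank K (V (d + e + k)) = (d + e + k + 2).choose 2 :=
    finrank_homogeneousSubmodule K 2 _
  have hsup := Submodule.finrank_sup_add_finrank_inf_eq A B
  set g := f.domRestrict (V (d + e + k)) with hg
  have hgs : LinearMap.range g = ⊤ := LinearMap.range_eq_top.mpr fun w => by
    obtain ⟨p, hp, rfl⟩ := hf w
    exact ⟨⟨p, hp⟩, rfl⟩
  have hrk := LinearMap.finrank_range_add_finrank_ker g
  rw [hgs, finrank_top] at hrk
  have hker : Module.finrank K ↥(A ⊔ B) ≤ Module.finrank K (LinearMap.ker g) := by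
    have hle : A ⊔ B ≤ (LinearMap.ker g).map (V (d + e + k)).subtype := by
      refine sup_le ?_ ?_
      · rintro x hx
        refine ⟨⟨x, hAV hx⟩, ?_, rfl⟩
        obtain ⟨a, -, rfl⟩ := hx
        exact hfG a
      · rintro x hx
        refine ⟨⟨x, hBV hx⟩, ?_, rfl⟩
        obtain ⟨a, -, rfl⟩ := hx
        exact hfH a
    refine (Submodule.finrank_mono hle).trans ?_
    exact Submodule.finrank_map_le _ _
  -- dim V(d+e+k) - dim V(e+k) - dim V(d+k) + dim V(k) is exactly de.
  have e1 := two_mul_choose_two (e + k)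
  have e2 := two_mul_choose_two (d + k)
  have e3 := two_mul_choose_two k
  have e4 := two_mul_choose_two (d + e + k)
  nlinarith

/-- An upper bound of Bézout type. Each of the homomorphisms `φ i` stands for a subscheme of the
plane with coordinate ring `R`, supported at one point, on which both `G` and `H` vanish. -/
theorem finrank_mul_card_le_mul_of_isRelPrime {K R ι : Type*} [Field K] [CommRing R] [Algebra K R]
    [Module.Finite K R] [Fintype ι] {G H : MvPolynomial (Fin 3) K} {d e : ℕ}
    (hG : G.IsHomogeneous d) (hH : H.IsHomogeneous e) (hG0 : G ≠ 0) (hH0 : H ≠ 0)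
    (hGH : IsRelPrime G H) (φ : ι → MvPolynomial (Fin 3) K →ₐ[K] R)
    (hφG : ∀ i, φ i G = 0) (hφH : ∀ i, φ i H = 0)
    (hsep : ∀ i j, i ≠ j → ∃ p : MvPolynomial (Fin 3) K,
      p.IsHomogeneous 2 ∧ φ j p = 0 ∧ IsUnit (φ i p))
    (hlin : ∀ i r, ∃ p : MvPolynomial (Fin 3) K, p.IsHomogeneous 1 ∧ φ i p = r) :
    Fintype.card ι * Module.finrank K R ≤ d * e := by
  classical
  rw [← smul_eq_mul (Fintype.card ι), ← Module.finrank_fintype_fun_eq_card K (η := ι), smul_eq_mul,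
    Module.finrank_fintype_fun_eq_card, ← Finset.card_univ, ← smul_eq_mul, ← Finset.sum_const,
    ← Module.finrank_pi_fintype K]
  -- Leaves room for one separating quadric per remaining point.
  set k := 2 * Fintype.card ι with hk
  refine finrank_le_mul_of_isRelPrime hG hH hG0 hH0 hGH
    (LinearMap.pi fun i => (φ i).toLinearMap) (fun a => ?_) (fun a => ?_) k fun w => ?_
  · ext i; simp [hφG]
  · ext i; simp [hφH]
  have key : ∀ i r, ∃ p : MvPolynomial (Fin 3) K, p.IsHomogeneous (d + e + k) ∧
      φ i p = r ∧ ∀ j, j ≠ i → φ j p = 0 := by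
    intro i r
    choose! s hs2 hs0 hsu using fun j (hj : i ≠ j) => hsep i j hj
    set S := ∏ j ∈ Finset.univ.erase i, s j with hS
    have hSh : S.IsHomogeneous (2 * (Fintype.card ι - 1)) := by
      have := IsHomogeneous.prod (Finset.univ.erase i) s (fun _ => 2) fun j hj =>
        hs2 j (Finset.ne_of_mem_erase hj).symm
      rwa [Finset.sum_const, Finset.card_erase_of_mem (Finset.mem_univ i), Finset.card_univ,
        smul_eq_mul, mul_comm] at this
    have hSu : IsUnit (φ i S) := by
      rw [hS, map_prod]
      exact IsUnit.prod_iff.mpr fun j hj => hsu j (Finset.ne_of_mem_erase hj).symm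
    obtain ⟨u, hu⟩ := hSu
    -- Powers of `l` raise the degree without changing the value under `φ i`.
    obtain ⟨l, hl, hl1⟩ := hlin i 1
    obtain ⟨p, hp, hpr⟩ := hlin i (↑u⁻¹ * r)
    refine ⟨S * (p * l ^ (d + e + 1)), ?_, ?_, fun j hj => ?_⟩
    · have hcard : 0 < Fintype.card ι := Fintype.card_pos_iff.mpr ⟨i⟩
      have := hSh.mul (hp.mul (hl.pow (d + e + 1)))
      rwa [show 2 * (Fintype.card ι - 1) + (1 + 1 * (d + e + 1)) = d + e + k by omega] at this
    · simp [← hu, hpr, hl1]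
    · rw [map_mul, hS, map_prod, Finset.prod_eq_zero (Finset.mem_erase.mpr ⟨hj, Finset.mem_univ j⟩)
        (hs0 j hj.symm), zero_mul]
  choose p hp hpi hpj using key
  refine ⟨∑ i, p i (w i), IsHomogeneous.sum _ _ _ fun i _ => hp i _, ?_⟩
  ext j
  simp only [LinearMap.pi_apply, AlgHom.toLinearMap_apply, map_sum]
  rw [Finset.sum_eq_single j (fun i _ hij => hpj _ _ _ hij.symm) (by simp), hpi]

/-- The linear form with coefficients `c`. -/
noncomputable def linearForm {K : Type*} [CommSemiring K] (c : Fin 3 → K) :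
    MvPolynomial (Fin 3) K :=
  ∑ i, C (c i) * X i

theorem isHomogeneous_linearForm {K : Type*} [CommSemiring K] (c : Fin 3 → K) :
    (linearForm c).IsHomogeneous 1 :=
  IsHomogeneous.sum _ _ _ fun _ _ => isHomogeneous_C_mul_X _ _

theorem aeval_linearForm {K A : Type*} [CommSemiring K] [CommSemiring A] [Algebra K A]
    (c : Fin 3 → K) (v : Fin 3 → A) : aeval v (linearForm c) = ∑ i, c i • v i := by
  simp [linearForm, Algebra.smul_def]

end MvPolynomial

theorem exists_dotProduct_eq_zero_ne_zero {K : Type*} [Field K] {v w : Fin 3 → K}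
    (h : v ∉ Submodule.span K {w}) : ∃ c : Fin 3 → K, c ⬝ᵥ w = 0 ∧ c ⬝ᵥ v ≠ 0 := by
  obtain ⟨f, hfv, hf⟩ := Submodule.exists_le_ker_of_notMem h
  obtain ⟨c, rfl⟩ := (dotProductEquiv K (Fin 3)).surjective f
  exact ⟨c, by simpa using hf (Submodule.mem_span_singleton_self w), by simpa using hfv⟩

theorem exists_dotProduct_eq {K : Type*} [Field K] {v w : Fin 3 → K}
    (h : LinearIndependent K ![v, w]) (a b : K) :
    ∃ c : Fin 3 → K, c ⬝ᵥ v = a ∧ c ⬝ᵥ w = b := by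
  have hv : v ∉ Submodule.span K {w} := by
    intro hv
    obtain ⟨r, rfl⟩ := Submodule.mem_span_singleton.mp hv
    have := LinearIndependent.pair_iff.mp h 1 (-r) (by simp)
    simp at this
  have hw : w ∉ Submodule.span K {v} := by
    intro hw
    obtain ⟨r, rfl⟩ := Submodule.mem_span_singleton.mp hw
    have := LinearIndependent.pair_iff.mp h (-r) 1 (by simp)
    simp at this
  obtain ⟨c, hc0, hc⟩ := exists_dotProduct_eq_zero_ne_zero hv
  obtain ⟨c', hc0', hc'⟩ := exists_dotProduct_eq_zero_ne_zero hw
  refine ⟨(a / (c ⬝ᵥ v)) • c + (b / (c' ⬝ᵥ w)) • c', ?_, ?_⟩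
  · simp [hc0', hc]
  · simp [hc0, hc']

namespace MvPolynomial

/-- Bézout's inequality for coprime forms in three variables. -/
theorem card_le_mul_of_isRelPrime {K ι : Type*} [Field K] [Fintype ι]
    {G H : MvPolynomial (Fin 3) K} {d e : ℕ}
    (hG : G.IsHomogeneous d) (hH : H.IsHomogeneous e) (hG0 : G ≠ 0) (hH0 : H ≠ 0)
    (hGH : IsRelPrime G H) (v : ι → Fin 3 → K) (hv0 : ∀ i, v i ≠ 0)
    (hv : ∀ i j, i ≠ j → v i ∉ Submodule.span K {v j})
    (hvG : ∀ i, eval (v i) G = 0) (hvH : ∀ i, eval (v i) H = 0) :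
    Fintype.card ι ≤ d * e := by
  have := finrank_mul_card_le_mul_of_isRelPrime hG hH hG0 hH0 hGH (R := K)
    (fun i => aeval (v i)) (fun i => by simpa using hvG i) (fun i => by simpa using hvH i) ?_ ?_
  · simpa using this
  · intro i j hij
    obtain ⟨c, hc0, hc⟩ := exists_dotProduct_eq_zero_ne_zero (hv i j hij)
    refine ⟨linearForm c ^ 2, (isHomogeneous_linearForm c).pow 2, ?_, ?_⟩
    · rw [map_pow, aeval_linearForm]
      simpa [dotProduct] using hc0
    · rw [map_pow, aeval_linearForm]
      simpa [dotProduct] using hc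
  · intro i r
    have : v i ∉ Submodule.span K {(0 : Fin 3 → K)} := by simpa using hv0 i
    obtain ⟨c, -, hc⟩ := exists_dotProduct_eq_zero_ne_zero this
    refine ⟨linearForm ((r / (c ⬝ᵥ v i)) • c), isHomogeneous_linearForm _, ?_⟩
    have h2 : ((r / (c ⬝ᵥ v i)) • c) ⬝ᵥ v i = r := by simp [hc]
    rw [aeval_linearForm]
    simpa [dotProduct] using h2

/-! ### Dual numbers and tangency. -/

theorem _root_.finrank_dualNumber (K : Type*) [Field K] : Module.finrank K (DualNumber K) = 2 :=
  (Module.finrank_prod (R := K) (M := K) (M' := K)).trans (by simp)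

instance _root_.finite_dualNumber (K : Type*) [Field K] : Module.Finite K (DualNumber K) :=
  inferInstanceAs (Module.Finite K (K × K))

/-- The `K[ε]`-valued point `v + ε t`. -/
noncomputable def dualPoint {K : Type*} [Field K] (v t : Fin 3 → K) :
    MvPolynomial (Fin 3) K →ₐ[K] DualNumber K :=
  aeval fun i => TrivSqZeroExt.inl (v i) + TrivSqZeroExt.inr (t i)

/-- First-order Taylor expansion, as ε² = 0. Thus `p` maps to zero exactly when it vanishes at `v`
and its gradient there kills `t`. -/
theorem dualPoint_eq {K : Type*} [Field K] (v t : Fin 3 → K) (p : MvPolynomial (Fin 3) K) :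
    dualPoint v t p = TrivSqZeroExt.inl (eval v p) +
      TrivSqZeroExt.inr (∑ i, t i * eval v (pderiv i p)) := by
  induction p using MvPolynomial.induction_on with
  | C a =>
    simp only [dualPoint, algHom_C, eval_C, pderiv_C, map_zero, mul_zero, Finset.sum_const_zero]
    simp [TrivSqZeroExt.algebraMap_eq_inl]
  | add p q hp hq =>
    rw [map_add, hp, hq]
    simp only [map_add, mul_add, Finset.sum_add_distrib, TrivSqZeroExt.inl_add,
      TrivSqZeroExt.inr_add]
    abel
  | mul_X p j hp =>
    rw [map_mul, hp]
    have hX : dualPoint v t (X j) = TrivSqZeroExt.inl (v j) + TrivSqZeroExt.inr (t j) := by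
      simp [dualPoint]
    rw [hX]
    ext
    · simp
    · simp only [TrivSqZeroExt.snd_mul, TrivSqZeroExt.snd_add, TrivSqZeroExt.fst_add,
        TrivSqZeroExt.fst_inl, TrivSqZeroExt.fst_inr, TrivSqZeroExt.snd_inl,
        TrivSqZeroExt.snd_inr, Derivation.leibniz, pderiv_X, smul_eq_mul, map_add, map_mul, eval_X,
        mul_add, Finset.sum_add_distrib]
      simp [Pi.single_apply, Fin.sum_univ_three]
      fin_cases j <;> simp <;> ring

/-- Bézout's inequality for coprime forms in three variables that are tangent to each other at all
the given points: each of these counts twice. -/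
theorem card_mul_two_le_mul_of_isRelPrime {K ι : Type*} [Field K] [Fintype ι]
    {G H : MvPolynomial (Fin 3) K} {d e : ℕ}
    (hG : G.IsHomogeneous d) (hH : H.IsHomogeneous e) (hG0 : G ≠ 0) (hH0 : H ≠ 0)
    (hGH : IsRelPrime G H) (v t : ι → Fin 3 → K)
    (hv : ∀ i j, i ≠ j → v i ∉ Submodule.span K {v j})
    (ht : ∀ i, LinearIndependent K ![v i, t i])
    (hvG : ∀ i, dualPoint (v i) (t i) G = 0) (hvH : ∀ i, dualPoint (v i) (t i) H = 0) :
    Fintype.card ι * 2 ≤ d * e := by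
  have hform : ∀ i c, dualPoint (v i) (t i) (linearForm c) =
      TrivSqZeroExt.inl (c ⬝ᵥ v i) + TrivSqZeroExt.inr (c ⬝ᵥ t i) := fun i c => by
    rw [dualPoint, aeval_linearForm]
    ext <;> simp [dotProduct, Fin.sum_univ_three]
  rw [← finrank_dualNumber K]
  refine finrank_mul_card_le_mul_of_isRelPrime hG hH hG0 hH0 hGH
    (fun i => dualPoint (v i) (t i)) hvG hvH ?_ ?_
  · intro i j hij
    obtain ⟨c, hc0, hc⟩ := exists_dotProduct_eq_zero_ne_zero (hv i j hij)
    -- The form itself may keep an ε-part at the point `j`; squaring removes it. This is why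
    -- separation is asked for in degree 2.
    refine ⟨linearForm c ^ 2, (isHomogeneous_linearForm c).pow 2, ?_, ?_⟩
    · rw [map_pow, hform, hc0, sq]
      simp
    · rw [map_pow, hform]
      refine IsUnit.pow 2 (TrivSqZeroExt.isUnit_iff_isUnit_fst.mpr ?_)
      simpa using hc
  · intro i r
    obtain ⟨c, hc1, hc2⟩ := exists_dotProduct_eq (ht i) r.fst r.snd
    refine ⟨linearForm c, isHomogeneous_linearForm c, ?_⟩
    rw [hform, hc1, hc2, TrivSqZeroExt.inl_fst_add_inr_snd_eq]

end MvPolynomial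

/-- The kernel of `g` has dimension at least 2, so the line through `v` cannot contain it. For `g` a
gradient this yields a tangent direction, also at singular points, where `g = 0`. -/
theorem exists_linearIndependent_pair_dotProduct_eq_zero {K : Type*} [Field K] {v : Fin 3 → K}
    (hv : v ≠ 0) (g : Fin 3 → K) :
    ∃ t : Fin 3 → K, LinearIndependent K ![v, t] ∧ g ⬝ᵥ t = 0 := by
  by_contra! h
  set f : (Fin 3 → K) →ₗ[K] K := dotProductEquiv K (Fin 3) g with hf
  have hle : LinearMap.ker f ≤ Submodule.span K {v} := by
    intro t ht
    by_contra hnot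
    refine h t ?_ (by simpa [hf] using ht)
    refine LinearIndependent.pair_iff.mpr fun a b hab => ?_
    have hb : b = 0 := by
      by_contra hb
      refine hnot (Submodule.mem_span_singleton.mpr ⟨-(b⁻¹ * a), ?_⟩)
      have h1 : a • v = -(b • t) := eq_neg_of_add_eq_zero_left hab
      rw [neg_smul, mul_smul, h1, smul_neg, neg_neg, smul_smul, inv_mul_cancel₀ hb, one_smul]
    subst hb
    simpa [hv] using hab
  have h1 := (Submodule.finrank_mono hle).trans (finrank_span_singleton (K := K) hv).le
  have h2 := LinearMap.finrank_range_add_finrank_ker f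
  have h3 := (LinearMap.range f).finrank_le
  simp at h2 h3
  omega

/-! ### The Stöhr–Voloch bound. -/

theorem isHomogeneous_frobeniusPhi {K : Type*} [Field K] {G : MvPolynomial (Fin 3) K} {d : ℕ}
    (hG : G.IsHomogeneous d) (q : ℕ) :
    (frobeniusPhi q G).IsHomogeneous (q + (d - 1)) :=
  IsHomogeneous.sum _ _ _ fun i _ => (isHomogeneous_X_pow i q).mul hG.pderiv

/-- At a rational point of `G` the form `Φ_q(G)` vanishes along every tangent vector of `G`. -/
theorem dualPoint_frobeniusPhi {K : Type*} [Field K] [Finite K] {G : MvPolynomial (Fin 3) K}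
    {d : ℕ} (hG : G.IsHomogeneous d) {v t : Fin 3 → K} (h : dualPoint v t G = 0) :
    dualPoint v t (frobeniusPhi (Nat.card K) G) = 0 := by
  have := Fintype.ofFinite K
  have hX : ∀ i, dualPoint v t (X i) = TrivSqZeroExt.inl (v i) + TrivSqZeroExt.inr (t i) :=
    fun i => by simp [dualPoint]
  -- (v + εt)^q = v^q + q v^(q-1) t ε, where v^q = v and q = 0 in `K`.
  have hXq : ∀ i, dualPoint v t (X i ^ Nat.card K) = TrivSqZeroExt.inl (v i) := fun i => by
    rw [map_pow, hX]
    ext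
    · simp [Nat.card_eq_fintype_card, FiniteField.pow_card]
    · rw [TrivSqZeroExt.snd_pow]
      simp [Nat.card_eq_fintype_card]
  -- Euler's relation at v + εt: the sum of (v_i + ε t_i) ∂_i G vanishes. Its ε t_i part vanishes by
  -- tangency, and what remains is the value of Φ_q(G).
  have hE := congrArg (dualPoint v t) hG.sum_X_mul_pderiv
  rw [map_nsmul, h, smul_zero, map_sum] at hE
  simp only [map_mul, hX, add_mul, Finset.sum_add_distrib] at hE
  have hT : ∑ i, TrivSqZeroExt.inr (t i) * dualPoint v t (pderiv i G) = 0 := by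
    have h0 : ∑ i, t i * eval v (pderiv i G) = 0 := by
      have := congrArg TrivSqZeroExt.snd h
      rw [dualPoint_eq] at this
      simpa using this
    have h1 : ∀ i, (TrivSqZeroExt.inr (t i) : DualNumber K) * dualPoint v t (pderiv i G) =
        TrivSqZeroExt.inr (t i * eval v (pderiv i G)) := fun i => by
      rw [dualPoint_eq]
      ext <;> simp
    simp only [h1]
    exact (map_sum (TrivSqZeroExt.inrHom K K) _ _).symm.trans (by rw [h0, map_zero])
  rw [hT, add_zero] at hE
  simpa only [frobeniusPhi, map_sum, map_mul, hXq] using hE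

theorem rep_notMem_span {K V : Type*} [Field K] [AddCommGroup V] [Module K V] {P Q : ℙ K V}
    (h : P ≠ Q) : P.rep ∉ Submodule.span K {Q.rep} := by
  intro hP
  obtain ⟨a, ha⟩ := Submodule.mem_span_singleton.mp hP
  apply h
  rw [← P.mk_rep, ← Q.mk_rep]
  exact (Projectivization.mk_eq_mk_iff' K _ _ P.rep_nonzero Q.rep_nonzero).mpr ⟨a, ha⟩

/-- The Stöhr-Voloch bound for Frobenius classical plane curves. -/
theorem ncard_rationalPoints_mul_two_le {K : Type*} [Field K] [Finite K]
    {G : MvPolynomial (Fin 3) K} {d : ℕ} (hG : G.IsHomogeneous d)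
    (hirr : Irreducible G) (hcl : IsFrobeniusClassical (Nat.card K) G) :
    (rationalPoints G).ncard * 2 ≤ d * (Nat.card K + (d - 1)) := by
  have := Fintype.ofFinite (rationalPoints G)
  rw [← Nat.card_coe_set_eq, Nat.card_eq_fintype_card]
  choose t ht htG using fun P : rationalPoints G =>
    exists_linearIndependent_pair_dotProduct_eq_zero P.1.rep_nonzero
      fun i => eval P.1.rep (pderiv i G)
  have hvG : ∀ P : rationalPoints G, dualPoint P.1.rep (t P) G = 0 := fun P => by
    have h0 : eval P.1.rep G = 0 := P.2
    have h1 : ∑ i, t P i * eval P.1.rep (pderiv i G) = 0 := by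
      rw [← htG P, dotProduct]
      exact Finset.sum_congr rfl fun i _ => mul_comm _ _
    rw [dualPoint_eq, h0, h1]
    simp
  refine card_mul_two_le_mul_of_isRelPrime hG (isHomogeneous_frobeniusPhi hG _) hirr.ne_zero
    ?_ (hirr.isRelPrime_iff_not_dvd.mpr hcl) (fun P => P.1.rep) t
    (fun P Q hPQ => rep_notMem_span fun h => hPQ (Subtype.ext h)) ht hvG
    fun P => dualPoint_frobeniusPhi hG (hvG P)
  intro h0
  exact hcl (by rw [IsFrobeniusNonclassical, h0]; exact dvd_zero G)

/-! ### Descent along the Frobenius. -/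

section Frobenius

variable {K L : Type*} [Field K] [Finite K] [Field L] [Algebra K L]

/-- X^q - X has at most q roots, and the image of `K` already supplies q of them. -/
theorem mem_range_algebraMap_of_pow_card_eq {x : L} (hx : x ^ Nat.card K = x) :
    x ∈ Set.range (algebraMap K L) := by
  classical
  have := Fintype.ofFinite K
  rw [Nat.card_eq_fintype_card] at hx
  have h1 := FiniteField.X_pow_card_sub_X_ne_zero L (Fintype.one_lt_card (α := K))
  set s : Finset L := Finset.univ.image (algebraMap K L) with hs
  have hcard : s.card = Fintype.card K := by
    rw [hs, Finset.card_image_of_injective _ (algebraMap K L).injective, Finset.card_univ]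
  set p : Polynomial L := Polynomial.X ^ Fintype.card K - Polynomial.X with hp
  have hsub : s ⊆ p.roots.toFinset := by
    intro y hy
    obtain ⟨a, -, rfl⟩ := Finset.mem_image.mp hy
    rw [Multiset.mem_toFinset, Polynomial.mem_roots h1]
    simp [hp, Polynomial.IsRoot, ← map_pow, FiniteField.pow_card]
  have heq := Finset.eq_of_subset_of_card_le hsub (by
    rw [hcard]
    refine (Multiset.toFinset_card_le _).trans ((Polynomial.card_roots' _).trans ?_)
    rw [hp, FiniteField.X_pow_card_sub_X_natDegree_eq L (Fintype.one_lt_card (α := K))])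
  have hx' : x ∈ s := by
    rw [heq, Multiset.mem_toFinset, Polynomial.mem_roots h1]
    simp [hp, Polynomial.IsRoot, hx]
  obtain ⟨a, -, rfl⟩ := Finset.mem_image.mp hx'
  exact ⟨a, rfl⟩

variable (K L) in
/-- The Frobenius endomorphism `x ↦ x ^ #K` of a `K`-algebra. -/
noncomputable def cardFrobenius : L →ₐ[K] L :=
  letI := Fintype.ofFinite K
  FiniteField.frobeniusAlgHom K L

theorem cardFrobenius_apply (x : L) : cardFrobenius K L x = x ^ Nat.card K := by
  let := Fintype.ofFinite K
  rw [Nat.card_eq_fintype_card]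
  rfl

variable {σ : Type*}

theorem MvPolynomial.mem_range_map_of_map_cardFrobenius_eq {p : MvPolynomial σ L}
    (hp : map (cardFrobenius K L : L →+* L) p = p) :
    p ∈ Set.range (map (σ := σ) (algebraMap K L)) := by
  rw [mem_range_map_iff_coeffs_subset]
  intro x hx
  obtain ⟨d, -, rfl⟩ := mem_coeffs_iff.mp hx
  apply mem_range_algebraMap_of_pow_card_eq (K := K)
  rw [← cardFrobenius_apply (K := K)]
  conv_rhs => rw [← hp]
  rw [coeff_map]
  rfl

theorem MvPolynomial.map_cardFrobenius_map_algebraMap (p : MvPolynomial σ K) :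
    map (cardFrobenius K L : L →+* L) (map (algebraMap K L) p) = map (algebraMap K L) p := by
  have h : (cardFrobenius K L : L →+* L).comp (algebraMap K L) = algebraMap K L := by
    ext x
    simp
  rw [map_map, h]

/-- Divisibility of polynomials over a finite field may be tested over any extension field. -/
theorem MvPolynomial.dvd_of_map_dvd_map {p r : MvPolynomial σ K} (hp : p ≠ 0)
    (h : map (algebraMap K L) p ∣ map (algebraMap K L) r) : p ∣ r := by
  have hinj := map_injective (σ := σ) (algebraMap K L) (algebraMap K L).injective
  obtain ⟨c, hc⟩ := h
  have hp' : map (algebraMap K L) p ≠ 0 := (map_ne_zero_iff _ hinj).mpr hp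
  -- Frobenius fixes divisor and dividend, hence the quotient `c`, which therefore has coefficients
  -- in `K`.
  have h1 := congrArg (map (cardFrobenius K L : L →+* L)) hc
  rw [map_mul, map_cardFrobenius_map_algebraMap, map_cardFrobenius_map_algebraMap, hc] at h1
  obtain ⟨c', rfl⟩ := mem_range_map_of_map_cardFrobenius_eq (mul_left_cancel₀ hp' h1).symm
  exact ⟨c', hinj (by rw [hc, map_mul])⟩

/-- Finitely many algebraic elements generate a finite field of order q^n, on which the n-th iterate
x ↦ x^(q^n) is the identity. -/
theorem exists_iterate_cardFrobenius_eq [Algebra.IsAlgebraic K L] (s : Finset L) :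
    ∃ n, 0 < n ∧ ∀ x ∈ s, (cardFrobenius K L)^[n] x = x := by
  set E := IntermediateField.adjoin K (s : Set L) with hE
  have hfin : FiniteDimensional K E :=
    IntermediateField.finiteDimensional_adjoin fun x _ => Algebra.IsIntegral.isIntegral x
  have : Finite E := Module.finite_of_finite K
  have := Fintype.ofFinite E
  have := Fintype.ofFinite K
  have hcard := Module.card_eq_pow_finrank (K := K) (V := E)
  refine ⟨Module.finrank K E, Module.finrank_pos, fun x hx => ?_⟩
  have hx' : x ∈ E := IntermediateField.subset_adjoin K _ hx
  have h1 : ∀ n, (cardFrobenius K L)^[n] x = x ^ Nat.card K ^ n := fun n => by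
    induction n with
    | zero => simp
    | succ n ih => rw [Function.iterate_succ_apply', ih, cardFrobenius_apply, ← pow_mul, pow_succ]
  have h2 := FiniteField.pow_card (⟨x, hx'⟩ : E)
  rw [h1, Nat.card_eq_fintype_card, ← hcard]
  exact congrArg Subtype.val h2

theorem MvPolynomial.exists_iterate_map_cardFrobenius_eq [Algebra.IsAlgebraic K L]
    (A : MvPolynomial σ L) :
    ∃ n, 0 < n ∧ (map (σ := σ) (cardFrobenius K L : L →+* L))^[n] A = A := by
  classical
  obtain ⟨n, hn, h⟩ := exists_iterate_cardFrobenius_eq (K := K) (A.support.image A.coeff)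
  refine ⟨n, hn, ?_⟩
  have hc : ∀ (k : ℕ) d, coeff d ((map (σ := σ) (cardFrobenius K L : L →+* L))^[k] A) =
      (cardFrobenius K L)^[k] (coeff d A) := fun k d => by
    induction k with
    | zero => rfl
    | succ k ih => rw [Function.iterate_succ_apply', coeff_map, ih, Function.iterate_succ_apply']; rfl
  ext d
  rw [hc]
  by_cases hd : d ∈ A.support
  · exact h _ (Finset.mem_image_of_mem _ hd)
  · rw [notMem_support_iff.mp hd]
    exact Function.iterate_fixed (map_zero _) n

end Frobenius

/-! ### Frobenius conjugates of an irreducible factor. -/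

theorem MvPolynomial.eq_of_associated_of_coeff_eq_one {σ L : Type*} [Field L]
    {A B : MvPolynomial σ L} {μ : σ →₀ ℕ} (hA : coeff μ A = 1) (hB : coeff μ B = 1)
    (h : Associated A B) : A = B := by
  obtain ⟨u, rfl⟩ := h
  obtain ⟨c, -, hc⟩ := MvPolynomial.isUnit_iff_eq_C_of_isReduced.mp u.isUnit
  rw [hc, mul_comm, coeff_C_mul, hA, mul_one] at hB
  rw [hc, hB, C_1, mul_one]

theorem MvPolynomial.irreducible_map_cardFrobenius {K L σ : Type*} [Field K] [Finite K] [Field L]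
    [Algebra K L] [Algebra.IsAlgebraic K L] {A : MvPolynomial σ L} (hA : Irreducible A) :
    Irreducible (map (cardFrobenius K L : L →+* L) A) := by
  let e : L ≃ₐ[K] L := AlgEquiv.ofBijective (cardFrobenius K L)
    (Algebra.IsAlgebraic.algHom_bijective _)
  exact (MulEquiv.irreducible_iff (mapEquiv σ (e : L ≃+* L))).mpr hA

/-- The orbit product of `A` under a ring endomorphism `T`, for an irreducible divisor `A` of a
fixed element whose conjugates are pairwise equal or non-associated. -/
theorem exists_orbit_prod {R : Type*} [CommRing R] [IsDomain R] [UniqueFactorizationMonoid R]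
    (T : R →+* R) {A g : R} (hirr : ∀ i, Irreducible (T^[i] A)) (hdvd : ∀ i, T^[i] A ∣ g)
    (hper : A ∈ Function.periodicPts T)
    (heq : ∀ i j, Associated (T^[i] A) (T^[j] A) → T^[i] A = T^[j] A) :
    ∃ n > 0, (∀ i < n, ∀ j < n, i ≠ j → IsRelPrime (T^[i] A) (T^[j] A)) ∧
      ∏ i ∈ Finset.range n, T^[i] A ∣ g ∧
      T (∏ i ∈ Finset.range n, T^[i] A) = ∏ i ∈ Finset.range n, T^[i] A := by
  have hrel : ∀ i < Function.minimalPeriod T A, ∀ j < Function.minimalPeriod T A, i ≠ j →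
      IsRelPrime (T^[i] A) (T^[j] A) := by
    intro i hi j hj hij
    refine (hirr i).isRelPrime_iff_not_dvd.mpr fun hd => hij ?_
    exact (Function.iterate_eq_iterate_iff_of_lt_minimalPeriod hi hj).mp
      (heq i j ((hirr i).associated_of_dvd (hirr j) hd))
  refine ⟨Function.minimalPeriod T A, Function.minimalPeriod_pos_of_mem_periodicPts hper, hrel,
    Finset.prod_dvd_of_isRelPrime
      (fun i hi j hj hij => hrel i (by simpa using hi) j (by simpa using hj) hij)
      fun i _ => hdvd i, ?_⟩
  -- `T` shifts the factors cyclically: the last one returns to `A`.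
  obtain ⟨k, hk⟩ : ∃ k, Function.minimalPeriod T A = k + 1 :=
    ⟨_, (Nat.succ_pred_eq_of_pos (Function.minimalPeriod_pos_of_mem_periodicPts hper)).symm⟩
  have h2 : T^[k + 1] A = A := by rw [← hk]; exact Function.iterate_minimalPeriod
  rw [hk, map_prod, Finset.prod_range_succ, Finset.prod_range_succ']
  simp only [← Function.iterate_succ_apply' (f := T), h2, Function.iterate_zero, id_eq]

section Conjugates

variable {K L : Type*} [Field K] [Finite K] [Field L] [Algebra K L]

theorem eval_map_cardFrobenius {σ : Type*} (v : σ → K) (B : MvPolynomial σ L) :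
    eval (fun i => algebraMap K L (v i)) (map (cardFrobenius K L : L →+* L) B) =
      cardFrobenius K L (eval (fun i => algebraMap K L (v i)) B) := by
  induction B using MvPolynomial.induction_on with
  | C a => simp
  | add p q hp hq => simp [hp, hq]
  | mul_X p i hp => simp [hp]

theorem eval_eq_zero_of_eval_iterate_map_cardFrobenius {σ : Type*} {v : σ → K}
    {A : MvPolynomial σ L} (i : ℕ)
    (h : eval (fun i => algebraMap K L (v i))
      ((map (σ := σ) (cardFrobenius K L : L →+* L))^[i] A) = 0) :
    eval (fun i => algebraMap K L (v i)) A = 0 := by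
  induction i with
  | zero => exact h
  | succ i ih =>
    rw [Function.iterate_succ_apply', eval_map_cardFrobenius] at h
    exact ih ((map_eq_zero _).mp h)

theorem exists_irreducible_factor_coeff_eq_one {σ : Type*} {g : MvPolynomial σ L} (hg : g ≠ 0)
    (hu : ¬ IsUnit g) : ∃ A μ, Irreducible A ∧ A ∣ g ∧ coeff μ A = 1 := by
  obtain ⟨A₀, hA₀, hA₀g⟩ := WfDvdMonoid.exists_irreducible_factor hu hg
  obtain ⟨μ, hμ⟩ := ne_zero_iff.mp hA₀.ne_zero
  have hass : Associated (C (coeff μ A₀)⁻¹ * A₀) A₀ :=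
    associated_unit_mul_left _ _ (IsUnit.map C (IsUnit.mk0 _ (inv_ne_zero hμ)))
  exact ⟨C (coeff μ A₀)⁻¹ * A₀, μ, hass.irreducible_iff.mpr hA₀, hass.dvd.trans hA₀g,
    by rw [coeff_C_mul, inv_mul_cancel₀ hμ]⟩

/-- If a form over a finite field is irreducible, but not over the algebraic extension `L`, then
it has a factor over `L` that is coprime to its Frobenius conjugate and passes through all
rational points. -/
theorem exists_conjugate_factors [Algebra.IsAlgebraic K L] {σ : Type*} {G : MvPolynomial σ K}
    (hG : Irreducible G) (hGL : ¬ Irreducible (map (algebraMap K L) G))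
    (hu : ¬ IsUnit (map (algebraMap K L) G)) :
    ∃ A B : MvPolynomial σ L, IsRelPrime A B ∧ A * B ∣ map (algebraMap K L) G ∧
      A.totalDegree = B.totalDegree ∧ ∀ v : σ → K, eval v G = 0 →
        eval (fun i => algebraMap K L (v i)) A = 0 ∧
        eval (fun i => algebraMap K L (v i)) B = 0 := by
  have hinj := map_injective (σ := σ) (algebraMap K L) (algebraMap K L).injective
  have hG0 : map (algebraMap K L) G ≠ 0 := (map_ne_zero_iff _ hinj).mpr hG.ne_zero
  obtain ⟨A, μ, hA, hAG, hAμ⟩ := exists_irreducible_factor_coeff_eq_one hG0 hu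
  obtain ⟨T, hT⟩ : ∃ T, T = map (σ := σ) (cardFrobenius K L : L →+* L) := ⟨_, rfl⟩
  have hTG : T (map (algebraMap K L) G) = map (algebraMap K L) G := by
    rw [hT]; exact map_cardFrobenius_map_algebraMap G
  have hTirr : ∀ i, Irreducible (T^[i] A) := fun i => by
    induction i with
    | zero => exact hA
    | succ i ih =>
      rw [Function.iterate_succ_apply', hT]
      exact irreducible_map_cardFrobenius (hT ▸ ih)
  have hTdvd : ∀ i, T^[i] A ∣ map (algebraMap K L) G := fun i => by
    induction i with
    | zero => exact hAG
    | succ i ih => rw [Function.iterate_succ_apply', ← hTG]; exact map_dvd T ih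
  -- Normalising one coefficient to 1 makes associated conjugates equal.
  have hTμ : ∀ i, coeff μ (T^[i] A) = 1 := fun i => by
    induction i with
    | zero => exact hAμ
    | succ i ih => rw [Function.iterate_succ_apply', hT, coeff_map, ← hT, ih, map_one]
  have hper : A ∈ Function.periodicPts T := by
    obtain ⟨k, hk, h⟩ := exists_iterate_map_cardFrobenius_eq (K := K) A
    exact ⟨k, hk, by rw [hT]; exact h⟩
  obtain ⟨n, hn0, hrel, hMG, hTM⟩ := exists_orbit_prod T hTirr hTdvd hper
    fun i j h => eq_of_associated_of_coeff_eq_one (hTμ i) (hTμ j) h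
  rw [hT] at hTM
  obtain ⟨m, hm⟩ := mem_range_map_of_map_cardFrobenius_eq hTM
  rw [← hT] at hm
  have hAM : A ∣ ∏ i ∈ Finset.range n, T^[i] A :=
    Finset.dvd_prod_of_mem (fun i => T^[i] A) (Finset.mem_range.mpr hn0)
  -- The orbit product descends to a nonunit divisor `m` of the irreducible `G`.
  have hmG : Associated m G := by
    have hM0 := ne_zero_of_dvd_ne_zero hG0 hMG
    have hd : m ∣ G := dvd_of_map_dvd_map (L := L)
      (by rintro rfl; exact hM0 (by rw [← hm, map_zero])) (by rwa [hm])
    refine ((hG.dvd_iff.mp hd).resolve_left fun hmu => ?_).symm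
    exact hA.not_isUnit (isUnit_of_dvd_unit hAM (hm ▸ hmu.map (map (algebraMap K L))))
  have hn1 : 1 < n := by
    by_contra hle
    obtain rfl : n = 1 := by omega
    rw [Finset.prod_range_one] at hm
    refine hGL ((hmG.map (map (algebraMap K L))).irreducible ?_)
    rw [hm]
    exact hA
  have hAB : IsRelPrime A (T A) := hrel 0 hn0 1 hn1 zero_ne_one
  refine ⟨A, T A, hAB, hAB.mul_dvd hAG (hTdvd 1), ?_, fun v hv => ?_⟩
  · rw [hT]
    simp only [totalDegree, support_map_of_injective A (cardFrobenius K L : L →+* L).injective]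
  -- A rational point on `G` is a zero of some conjugate of `A`. As Frobenius fixes the point, it is
  -- then a zero of `A` and of `T A`.
  · have hMw : eval (fun i => algebraMap K L (v i)) (∏ i ∈ Finset.range n, T^[i] A) = 0 := by
      obtain ⟨u, hu⟩ := hmG.symm
      rw [← hm, ← hu, map_mul, map_mul, eval_map,
        ← Function.comp_def (algebraMap K L) v, ← eval₂_comp, hv, map_zero, zero_mul]
    rw [map_prod] at hMw
    obtain ⟨i, -, hi⟩ := Finset.prod_eq_zero_iff.mp hMw
    rw [hT] at hi
    have hAv := eval_eq_zero_of_eval_iterate_map_cardFrobenius i hi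
    exact ⟨hAv, by rw [hT, eval_map_cardFrobenius, hAv, map_zero]⟩

end Conjugates

/-- An irreducible form over a finite field that is not absolutely irreducible has few points. -/
theorem ncard_rationalPoints_mul_four_le {K : Type*} [Field K] [Finite K]
    {G : MvPolynomial (Fin 3) K} {d : ℕ} (hG : G.IsHomogeneous d) (hd : 0 < d)
    (hirr : Irreducible G) (habs : ¬ IsAbsolutelyIrreducible G) :
    (rationalPoints G).ncard * 4 ≤ d * d := by
  set L := AlgebraicClosure K
  have hinj := map_injective (σ := Fin 3) (algebraMap K L) (algebraMap K L).injective
  have hG0 : map (algebraMap K L) G ≠ 0 := (map_ne_zero_iff _ hinj).mpr hirr.ne_zero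
  have hGL := hG.map (algebraMap K L)
  have hu : ¬ IsUnit (map (algebraMap K L) G) := fun hu => by
    have := (isUnit_iff_totalDegree_of_isReduced.mp hu).2
    rw [hGL.totalDegree hG0] at this
    omega
  obtain ⟨A, B, hAB, hdvd, hdeg, hv⟩ := exists_conjugate_factors hirr habs hu
  have hAB0 := ne_zero_of_dvd_ne_zero hG0 hdvd
  have hA0 := left_ne_zero_of_mul hAB0
  have hB0 := right_ne_zero_of_mul hAB0
  have h2 : 2 * A.totalDegree ≤ d := by
    have := totalDegree_le_of_dvd_of_isDomain hdvd hG0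
    rw [totalDegree_mul_of_isDomain hA0 hB0, hGL.totalDegree hG0] at this
    omega
  have := Fintype.ofFinite (rationalPoints G)
  rw [← Nat.card_coe_set_eq, Nat.card_eq_fintype_card]
  have hle := card_le_mul_of_isRelPrime (hGL.of_dvd hG0 ((dvd_mul_right A B).trans hdvd))
    (hGL.of_dvd hG0 ((dvd_mul_left B A).trans hdvd)) hA0 hB0 hAB
    (fun (P : rationalPoints G) i => algebraMap K L (P.1.rep i)) ?_ ?_
    (fun P => (hv _ P.2).1) (fun P => (hv _ P.2).2)
  · rw [← hdeg] at hle
    nlinarith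
  · intro P h
    refine P.1.rep_nonzero (funext fun i => ?_)
    simpa using congrFun h i
  · intro P Q hPQ hmem
    -- A linear form over `K` that separates the two points still separates them over `L`.
    obtain ⟨c, hc0, hc⟩ := exists_dotProduct_eq_zero_ne_zero
      (rep_notMem_span fun h => hPQ (Subtype.ext h) : P.1.rep ∉ Submodule.span K {Q.1.rep})
    obtain ⟨r, hr⟩ := Submodule.mem_span_singleton.mp hmem
    apply hc
    apply (algebraMap K L).injective
    have e1 : ∀ R : ℙ K (Fin 3 → K), algebraMap K L (c ⬝ᵥ R.rep) =
        (fun i => algebraMap K L (c i)) ⬝ᵥ fun i => algebraMap K L (R.rep i) := fun R => by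
      simp [dotProduct]
    rw [e1, ← hr, dotProduct_smul, ← e1, hc0]
    simp

/-! ### Lines, reducible curves and the final count. -/

theorem MvPolynomial.IsHomogeneous.isUnit_of_zero {σ K : Type*} [Field K] {F : MvPolynomial σ K}
    (hF : F.IsHomogeneous 0) (hF0 : F ≠ 0) : IsUnit F := by
  have h := (totalDegree_zero_iff_isHomogeneous _).mpr hF
  rw [totalDegree_eq_zero_iff_eq_C] at h
  rw [h]
  refine (IsUnit.mk0 _ fun h0 => hF0 ?_).map C
  rw [h, h0, C_0]

theorem MvPolynomial.IsHomogeneous.pos_of_not_isUnit {σ K : Type*} [Field K]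
    {F : MvPolynomial σ K} {d : ℕ} (hF : F.IsHomogeneous d) (hF0 : F ≠ 0) (hu : ¬ IsUnit F) :
    0 < d :=
  Nat.pos_of_ne_zero fun h => hu ((h ▸ hF : F.IsHomogeneous 0).isUnit_of_zero hF0)

theorem isAbsolutelyIrreducible_of_isHomogeneous_one {K : Type*} [Field K]
    {F : MvPolynomial (Fin 3) K} (hF : F.IsHomogeneous 1) (hF0 : F ≠ 0) :
    IsAbsolutelyIrreducible F := by
  have hinj := map_injective (σ := Fin 3) (algebraMap K (AlgebraicClosure K))
    (algebraMap K (AlgebraicClosure K)).injective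
  have h0 := (map_ne_zero_iff _ hinj).mpr hF0
  refine irreducible_of_totalDegree_eq_one ((hF.map _).totalDegree h0) fun x hx => ?_
  obtain ⟨d, hd⟩ := ne_zero_iff.mp h0
  exact IsUnit.mk0 _ fun hx0 => hd (zero_dvd_iff.mp (hx0 ▸ hx d))

/-- Lines over a finite field are Frobenius nonclassical. -/
theorem isFrobeniusNonclassical_of_isHomogeneous_one {K : Type*} [Field K] [Finite K]
    {F : MvPolynomial (Fin 3) K} (hF : F.IsHomogeneous 1) :
    IsFrobeniusNonclassical (Nat.card K) F := by
  have := Fintype.ofFinite K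
  have hc : ∀ i, pderiv i F = C (coeff 0 (pderiv i F)) := fun i =>
    totalDegree_eq_zero_iff_eq_C.mp ((totalDegree_zero_iff_isHomogeneous _).mpr hF.pderiv)
  have hE := hF.sum_X_mul_pderiv
  rw [one_smul] at hE
  -- The partial derivatives are constants c_i in `K`, fixed by Frobenius, so the q-th power of ∑
  -- c_i X_i is ∑ c_i X_i^q.
  have hpow : F ^ Nat.card K = frobeniusPhi (Nat.card K) F := by
    have h1 : F ^ Nat.card K = FiniteField.frobeniusAlgHom K (MvPolynomial (Fin 3) K) F := by
      rw [Nat.card_eq_fintype_card]; rfl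
    rw [h1]
    conv_lhs => rw [← hE]
    rw [map_sum, frobeniusPhi]
    refine Finset.sum_congr rfl fun i _ => ?_
    rw [map_mul, hc i, ← algebraMap_eq, AlgHom.commutes, Nat.card_eq_fintype_card]
    rfl
  rw [IsFrobeniusNonclassical, ← hpow]
  exact dvd_pow_self F Nat.card_pos.ne'

theorem rationalPoints_mul {K : Type*} [Field K] (F G : MvPolynomial (Fin 3) K) :
    rationalPoints (F * G) = rationalPoints F ∪ rationalPoints G := by
  ext P
  simp [rationalPoints]

/-- Every absolutely irreducible component of `F` is Frobenius classical. -/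
def HasClassicalComponents {K : Type*} [Field K] (F : MvPolynomial (Fin 3) K) : Prop :=
  ∀ G : MvPolynomial (Fin 3) K,
    IsAbsolutelyIrreducibleComponent G F → IsFrobeniusClassical (Nat.card K) G

theorem HasClassicalComponents.of_dvd {K : Type*} [Field K] {F G : MvPolynomial (Fin 3) K}
    (hF : HasClassicalComponents F) (h : G ∣ F) : HasClassicalComponents G :=
  fun A hA => hF A ⟨hA.1, hA.2.1, hA.2.2.trans h⟩

theorem HasClassicalComponents.two_le {K : Type*} [Field K] [Finite K]
    {F : MvPolynomial (Fin 3) K} (hcl : HasClassicalComponents F) {m : ℕ} (hF : IsPlaneCurve F m) :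
    2 ≤ m := by
  obtain ⟨hm, hF0, hFm⟩ := hF
  by_contra hlt
  obtain rfl : m = 1 := by omega
  exact hcl F ⟨⟨1, hm, hF0, hFm⟩, isAbsolutelyIrreducible_of_isHomogeneous_one hFm hF0, dvd_rfl⟩
    (isFrobeniusNonclassical_of_isHomogeneous_one hFm)

/-- The components of a reducible plane curve. -/
theorem IsPlaneCurve.exists_mul_eq {K : Type*} [Field K] {F : MvPolynomial (Fin 3) K} {m : ℕ}
    (hF : IsPlaneCurve F m) (hred : ¬ Irreducible F) :
    ∃ G H a b, F = G * H ∧ m = a + b ∧ IsPlaneCurve G a ∧ IsPlaneCurve H b := by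
  obtain ⟨hm, hF0, hFm⟩ := hF
  have hu : ¬ IsUnit F := fun hu => by
    have := (isUnit_iff_totalDegree_of_isReduced.mp hu).2
    rw [hFm.totalDegree hF0] at this
    omega
  obtain ⟨G, H, hG, hH, rfl⟩ : ∃ G H, ¬ IsUnit G ∧ ¬ IsUnit H ∧ F = G * H := by
    by_contra! h
    exact hred ⟨hu, fun G H hGH => by
      by_contra! h'
      exact h G H h'.1 h'.2 hGH⟩
  have hG0 := left_ne_zero_of_mul hF0
  have hH0 := right_ne_zero_of_mul hF0
  have hGh := hFm.of_dvd hF0 (dvd_mul_right G H)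
  have hHh := hFm.of_dvd hF0 (dvd_mul_left H G)
  refine ⟨G, H, _, _, rfl, ?_, ⟨hGh.pos_of_not_isUnit hG0 hG, hG0, hGh⟩,
    ⟨hHh.pos_of_not_isUnit hH0 hH, hH0, hHh⟩⟩
  rw [← hFm.totalDegree hF0, totalDegree_mul_of_isDomain hG0 hH0]

theorem ncard_rationalPoints_mul_two_le_of_irreducible {K : Type*} [Field K] [Finite K]
    {F : MvPolynomial (Fin 3) K} {m : ℕ} (hF : IsPlaneCurve F m) (hcl : HasClassicalComponents F)
    (hirr : Irreducible F) : 2 * (rationalPoints F).ncard ≤ m * (m + Nat.card K - 1) := by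
  have hK : 0 < Nat.card K := Nat.card_pos
  by_cases habs : IsAbsolutelyIrreducible F
  · have := ncard_rationalPoints_mul_two_le hF.2.2 hirr (hcl F ⟨⟨m, hF⟩, habs, dvd_rfl⟩)
    rw [show m + Nat.card K - 1 = Nat.card K + (m - 1) by have := hF.1; omega]
    omega
  · have := ncard_rationalPoints_mul_four_le hF.2.2 hF.1 hirr habs
    have h2 : m * m ≤ m * (m + Nat.card K - 1) := Nat.mul_le_mul_left m (by omega)
    omega

/-- Rests on (a + b)(a + b + q - 1) = a(a + q - 1) + b(b + q - 1) + 2ab. -/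
theorem ncard_rationalPoints_add_le {K : Type*} [Field K] [Finite K]
    {G H : MvPolynomial (Fin 3) K} {a b : ℕ}
    (hG : 2 * (rationalPoints G).ncard ≤ a * (a + Nat.card K - 1))
    (hH : 2 * (rationalPoints H).ncard ≤ b * (b + Nat.card K - 1)) :
    2 * (rationalPoints (G * H)).ncard + 2 * (a * b) ≤ (a + b) * (a + b + Nat.card K - 1) := by
  have hU := Set.ncard_union_le (rationalPoints G) (rationalPoints H)
  rw [rationalPoints_mul]
  obtain ⟨k, hk⟩ : ∃ k, Nat.card K = k + 1 :=
    ⟨_, (Nat.succ_pred_eq_of_pos Nat.card_pos).symm⟩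
  rw [hk] at hG hH ⊢
  simp only [← add_assoc, Nat.add_sub_cancel] at hG hH ⊢
  nlinarith

theorem HasClassicalComponents.ncard_rationalPoints_le {K : Type*} [Field K] [Finite K]
    {F : MvPolynomial (Fin 3) K} {m : ℕ} (hF : IsPlaneCurve F m)
    (hcl : HasClassicalComponents F) :
    2 * (rationalPoints F).ncard ≤ m * (m + Nat.card K - 1) := by
  induction m using Nat.strong_induction_on generalizing F with
  | _ m ih =>
    by_cases hirr : Irreducible F
    · exact ncard_rationalPoints_mul_two_le_of_irreducible hF hcl hirr
    obtain ⟨G, H, a, b, rfl, rfl, hG, hH⟩ := hF.exists_mul_eq hirr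
    have h1 := ih a (by have := hH.1; omega) hG (hcl.of_dvd (dvd_mul_right G H))
    have h2 := ih b (by have := hG.1; omega) hH (hcl.of_dvd (dvd_mul_left H G))
    have := ncard_rationalPoints_add_le h1 h2
    omega

theorem HasClassicalComponents.ncard_rationalPoints_add_le_of_reducible {K : Type*} [Field K]
    [Finite K] {F : MvPolynomial (Fin 3) K} {m : ℕ} (hF : IsPlaneCurve F m)
    (hcl : HasClassicalComponents F) (hred : ¬ Irreducible F) :
    4 ≤ m ∧ 2 * (rationalPoints F).ncard + 2 * (2 * m - 4) ≤ m * (m + Nat.card K - 1) := by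
  obtain ⟨G, H, a, b, rfl, rfl, hG, hH⟩ := hF.exists_mul_eq hred
  have hclG := hcl.of_dvd (dvd_mul_right G H)
  have hclH := hcl.of_dvd (dvd_mul_left H G)
  have h1 := hclG.two_le hG
  have h2 := hclH.two_le hH
  have h3 := ncard_rationalPoints_add_le (hclG.ncard_rationalPoints_le hG)
    (hclH.ncard_rationalPoints_le hH)
  -- This is (a - 2)(b - 2) ≥ 0.
  have h4 : 2 * (a + b) - 4 ≤ a * b := by
    obtain ⟨a, rfl⟩ := Nat.exists_eq_add_of_le h1
    obtain ⟨b, rfl⟩ := Nat.exists_eq_add_of_le h2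
    rw [Nat.sub_le_iff_le_add]
    nlinarith [Nat.zero_le (a * b)]
  exact ⟨by omega, by omega⟩

/-- Bound for the number of rational points, and criterion for absolute irreducibility, of a plane
curve of degree `m` over the field `K` with `q` elements. -/
theorem theorem4 {K : Type*} [Field K] [Finite K] (q : ℕ) (hq : Nat.card K = q)
    (F : MvPolynomial (Fin 3) K) (m : ℕ) (hF : IsPlaneCurve F m)
    (hcl : ∀ G : MvPolynomial (Fin 3) K,
      IsAbsolutelyIrreducibleComponent G F → IsFrobeniusClassical q G) :
    ((rationalPoints F).ncard : ℚ) ≤ (m : ℚ) * ((m : ℚ) + (q : ℚ) - 1) / 2 ∧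
    ((m : ℚ) * ((m : ℚ) + (q : ℚ) - 1) / 2 - max ((m : ℚ) - 1) (2 * (m : ℚ) - 5)
        ≤ ((rationalPoints F).ncard : ℚ) →
      IsAbsolutelyIrreducible F) := by
  subst hq
  have hcl' : HasClassicalComponents F := hcl
  have hK : 2 ≤ Nat.card K := Finite.one_lt_card
  have hKQ : (2 : ℚ) ≤ Nat.card K := by exact_mod_cast hK
  have hmQ : (1 : ℚ) ≤ m := by exact_mod_cast hF.1
  have hcast : ((m * (m + Nat.card K - 1) : ℕ) : ℚ) = m * ((m : ℚ) + Nat.card K - 1) := by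
    rw [Nat.cast_mul, Nat.cast_sub (by omega)]
    push_cast
    ring
  refine ⟨?_, fun hle => ?_⟩
  · have h := hcl'.ncard_rationalPoints_le hF
    have h' : ((2 * (rationalPoints F).ncard : ℕ) : ℚ) ≤ (m * (m + Nat.card K - 1) : ℕ) :=
      Nat.cast_le.mpr h
    rw [hcast] at h'
    push_cast at h'
    linarith
  · by_contra habs
    by_cases hirr : Irreducible F
    · have h := ncard_rationalPoints_mul_four_le hF.2.2 hF.1 hirr habs
      have h' : ((rationalPoints F).ncard : ℚ) * 4 ≤ m * m := by exact_mod_cast h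
      have hmK : (m : ℚ) * 2 ≤ m * Nat.card K := by gcongr
      -- With q ≥ 2, the bounds would give (m - 1)² + 3 ≤ 0 in the first case and (m - 3)² + 11 ≤ 0
      -- in the second.
      rcases max_choice ((m : ℚ) - 1) (2 * (m : ℚ) - 5) with hmax | hmax <;> rw [hmax] at hle
      · nlinarith [sq_nonneg ((m : ℚ) - 1)]
      · nlinarith [sq_nonneg ((m : ℚ) - 3)]
    · obtain ⟨hm4, h⟩ := hcl'.ncard_rationalPoints_add_le_of_reducible hF hirr
      have h' : ((2 * (rationalPoints F).ncard + 2 * (2 * m - 4) : ℕ) : ℚ) ≤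
        (m * (m + Nat.card K - 1) : ℕ) := Nat.cast_le.mpr h
      have hm4' : (4 : ℚ) ≤ m := by exact_mod_cast hm4
      rw [hcast, Nat.cast_add, Nat.cast_mul 2 (2 * m - 4), Nat.cast_sub (by omega)] at h'
      push_cast at h'
      -- The gap 2m - 4 exceeds 2m - 5 always, and m - 1 because m ≥ 4.
      rcases max_choice ((m : ℚ) - 1) (2 * (m : ℚ) - 5) with hmax | hmax <;> rw [hmax] at hle
      · linarith
      · linarith
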